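/- Let $\log$ denote the logarithm to base $2$, and let $\log^* x$ denote the iterated logarithm of a real number $x$: the least integer $k\ge 0$ such that applying $\log$ to $x$ successively $k$ times gives a value at most $1$. A binary tree is a rooted tree in which every node has at most two children; its size is its number of nodes. A straight-line orthogonal drawing of a tree with width $W$ and height $H$ places the nodes at distinct points of the integer grid $\{1,\dots,W\}\times\{1,\dots,H\}$ and draws each edge as the line segment between its endpoints, so that every edge is horizontal or vertical, no edge passes through a node other than its endpoints, and two distinct edges do not meet except at a common endpoint. There are absolute constants $C$ and $c$ such that for every integer $n\ge 2$, every real number $\tilde A$ with $\log n\le\tilde A\le n/\log n$, and every binary tree $T$ of size $n$, the tree $T$ has a straight-line orthogonal drawing with width at most $C\tilde A$ and height at most $(n/\tilde A)\,2^{c\log^*\tilde A}$. -/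

import Mathlib

noncomputable section

namespace BinaryTreeDrawing

/-- The base-two iterated logarithm: the least `k` such that taking `log₂` successively `k` times,
starting from `x`, yields a value at most `1`. -/
def logStar (x : ℝ) : ℕ :=
  sInf {k : ℕ | (Real.logb 2)^[k] x ≤ 1}

/-- `IsVertex t p` says that following the path `p` downwards from the root of `t`
(`false` for the left child, `true` for the right child) leads to a node of `t`.
The empty trees `nil` only mark absent children and are not nodes. -/
def IsVertex : BinaryTree Unit → List Bool → Prop
  | .nil, _ => False
  | .node _ _ _, [] => True
  | .node _ l _, false :: p => IsVertex l p
  | .node _ _ r, true :: p => IsVertex r p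

/-- The nodes of a binary tree, named by their paths from the root. -/
abbrev Vertex (t : BinaryTree Unit) : Type :=
  {p : List Bool // IsVertex t p}

/-- The underlying graph of a binary tree: the edges join each node to its children. -/
def treeGraph (t : BinaryTree Unit) : SimpleGraph (Vertex t) where
  Adj u v := (∃ b : Bool, v.1 = u.1 ++ [b]) ∨ (∃ b : Bool, u.1 = v.1 ++ [b])
  symm := ⟨fun _ _ h => h.symm⟩
  loopless := ⟨fun u h => by
    rcases h with ⟨b, h⟩ | ⟨b, h⟩ <;> simpa using congrArg List.length h⟩

/-- An integer grid point regarded as a point of the real plane. -/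
def gridPoint (z : ℤ × ℤ) : ℝ × ℝ := ((z.1 : ℝ), (z.2 : ℝ))

/-- `pos` is a planar straight-line orthogonal drawing of the graph `G` on the integer grid
`{1, …, W} × {1, …, H}`. -/
structure IsStraightLineOrthogonalDrawing {V : Type*} (G : SimpleGraph V) (W H : ℕ)
    (pos : V → ℤ × ℤ) : Prop where
  /-- Every vertex lies on the grid. -/
  mem_grid : ∀ v, 1 ≤ (pos v).1 ∧ (pos v).1 ≤ W ∧ 1 ≤ (pos v).2 ∧ (pos v).2 ≤ H
  /-- Distinct vertices are placed at distinct points. -/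
  injective : Function.Injective pos
  /-- Every edge is vertical or horizontal. -/
  orthogonal : ∀ u v, G.Adj u v → (pos u).1 = (pos v).1 ∨ (pos u).2 = (pos v).2
  /-- An edge passes through no vertex other than its own endpoints. -/
  avoids_vertices : ∀ u v w, G.Adj u v →
    gridPoint (pos w) ∈ segment ℝ (gridPoint (pos u)) (gridPoint (pos v)) → w = u ∨ w = v
  /-- Two distinct edges meet at most at a common endpoint. -/
  noncrossing : ∀ u v u' v', G.Adj u v → G.Adj u' v' → s(u, v) ≠ s(u', v') →
    ∀ p ∈ segment ℝ (gridPoint (pos u)) (gridPoint (pos v)) ∩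
        segment ℝ (gridPoint (pos u')) (gridPoint (pos v')),
      ∃ w, (w = u ∨ w = v) ∧ (w = u' ∨ w = v') ∧ p = gridPoint (pos w)

end BinaryTreeDrawing

end

namespace BinaryTreeDrawing

/-! Decompose the tree along a heavy path and draw spines (paths with hanging subtrees) by winding.
Suppose spines of size at most `B` fit in a box of width `L` and height `w`. Cut a long spine
greedily into blocks of size at most `B`, each followed by one turning vertex. Lay each block
sideways, so that it occupies `w` columns and `L` rows, put the subtree of the turning vertex above
it, and stack the results (`SpineFits.snoc`, `SpineFits.append`). Hanging subtrees are drawn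
recursively along heavy paths. Their sizes halve, so a spine of size at most `2 ^ j` needs width
about `w + j`, while its height is `O(L * (size / B + 1))` (`exists_spineFits`).

This is bootstrapped. Let `LevelBound N K s` be the bound at width `4 * N`, with loss factor `K`.
From the bound at `a`, about `log N`, take `B` about `a * N / (2 * K)`: such spines fit in width `4
* a` and height `N`. Winding then gives the bound at `N` with `K` replaced by `112 * K`
(`LevelBound.step`). Iterating over logarithms costs a constant factor per step, hence `2 ^ O(log*
A)` in all (`exists_levelBound`).

Geometry is done with lattice points. Each vertex owns the edge to its parent, without the parent.
Disjointness of these half-open edges encodes planarity, and rounding transfers it to real segments.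
-/

/-! ### Lattice drawings and grid symmetries -/

/-- Two grid points are aligned if they share a row or a column. -/
def Aligned (q p : ℤ × ℤ) : Prop := q.1 = p.1 ∨ q.2 = p.2

/-- The grid points of the segment from `q` to `p` (for aligned `q`, `p`), without `q` itself. -/
def halfEdge (q p : ℤ × ℤ) : Set (ℤ × ℤ) :=
  {x | ¬ (x.1 = q.1 ∧ x.2 = q.2) ∧ min q.1 p.1 ≤ x.1 ∧ x.1 ≤ max q.1 p.1 ∧
    min q.2 p.2 ≤ x.2 ∧ x.2 ≤ max q.2 p.2}

/-- `Draws t q S`: the tree `t` can be drawn so that its root is joined to the point `q`, and the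
drawing, including the edge to `q` but not `q` itself, stays inside `S`. -/
inductive Draws : BinaryTree Unit → ℤ × ℤ → Set (ℤ × ℤ) → Prop
  | nil (q S) : Draws .nil q S
  | node {l r q S} (p Sl Sr) (hal : Aligned q p) (hne : q ≠ p) (hl : Draws l p Sl)
      (hr : Draws r p Sr) (hlr : Disjoint Sl Sr) (hpl : Disjoint (halfEdge q p) Sl)
      (hpr : Disjoint (halfEdge q p) Sr) (hS : halfEdge q p ⊆ S) (hlS : Sl ⊆ S) (hrS : Sr ⊆ S) :
      Draws (.node () l r) q S

theorem Draws.mono {t q S S'} (h : Draws t q S) (hS : S ⊆ S') : Draws t q S' := by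
  cases h with
  | nil => exact .nil _ _
  | node p Sl Sr hal hne hl hr hlr hpl hpr h1 h2 h3 =>
    exact .node p Sl Sr hal hne hl hr hlr hpl hpr (h1.trans hS) (h2.trans hS) (h3.trans hS)

/-- A symmetry of the grid. -/
structure IsGridSymm (φ : ℤ × ℤ ≃ ℤ × ℤ) : Prop where
  aligned : ∀ q p, Aligned (φ q) (φ p) ↔ Aligned q p
  halfEdge : ∀ q p x, φ x ∈ halfEdge (φ q) (φ p) ↔ x ∈ halfEdge q p

theorem IsGridSymm.symm {φ : ℤ × ℤ ≃ ℤ × ℤ} (h : IsGridSymm φ) : IsGridSymm φ.symm where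
  aligned q p := by simpa using (h.aligned (φ.symm q) (φ.symm p)).symm
  halfEdge q p x := by simpa using (h.halfEdge (φ.symm q) (φ.symm p) (φ.symm x)).symm

theorem IsGridSymm.image_halfEdge {φ : ℤ × ℤ ≃ ℤ × ℤ} (h : IsGridSymm φ) (q p : ℤ × ℤ) :
    φ '' BinaryTreeDrawing.halfEdge q p = BinaryTreeDrawing.halfEdge (φ q) (φ p) := by
  ext x
  obtain ⟨y, rfl⟩ := φ.surjective x
  rw [h.halfEdge, φ.injective.mem_set_image]

theorem Draws.map {φ : ℤ × ℤ ≃ ℤ × ℤ} (hφ : IsGridSymm φ) {t q S} (h : Draws t q S) :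
    Draws t (φ q) (φ '' S) := by
  induction h with
  | nil => exact .nil _ _
  | node p Sl Sr hal hne hl hr hlr hpl hpr h1 h2 h3 ihl ihr =>
    refine .node (φ p) (φ '' Sl) (φ '' Sr) ((hφ.aligned _ _).2 hal) (φ.injective.ne hne) ihl ihr
      ((Set.disjoint_image_iff φ.injective).2 hlr) ?_ ?_ ?_ (Set.image_mono h2)
      (Set.image_mono h3)
    all_goals rw [← hφ.image_halfEdge]
    · exact (Set.disjoint_image_iff φ.injective).2 hpl
    · exact (Set.disjoint_image_iff φ.injective).2 hpr
    · exact Set.image_mono h1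

/-- Translation by `(a, b)`. -/
def gridTranslate (a b : ℤ) : ℤ × ℤ ≃ ℤ × ℤ where
  toFun x := (x.1 + a, x.2 + b)
  invFun x := (x.1 - a, x.2 - b)
  left_inv x := by ext <;> simp
  right_inv x := by ext <;> simp

/-- Reflection in a vertical line, followed by a vertical translation. -/
def gridMirror (a b : ℤ) : ℤ × ℤ ≃ ℤ × ℤ where
  toFun x := (a - x.1, x.2 + b)
  invFun x := (a - x.1, x.2 - b)
  left_inv x := by ext <;> simp
  right_inv x := by ext <;> simp

/-- Point reflection. -/
def gridRotate (a b : ℤ) : ℤ × ℤ ≃ ℤ × ℤ where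
  toFun x := (a - x.1, b - x.2)
  invFun x := (a - x.1, b - x.2)
  left_inv x := by ext <;> simp
  right_inv x := by ext <;> simp

/-- Exchange of the coordinates, followed by a vertical translation. -/
def gridTranspose (b : ℤ) : ℤ × ℤ ≃ ℤ × ℤ where
  toFun x := (x.2, x.1 + b)
  invFun x := (x.2 - b, x.1)
  left_inv x := by ext <;> simp
  right_inv x := by ext <;> simp

theorem isGridSymm_translate (a b : ℤ) : IsGridSymm (gridTranslate a b) where
  aligned q p := by simp only [Aligned, gridTranslate, Equiv.coe_fn_mk]; omega
  halfEdge q p x := by simp only [halfEdge, gridTranslate, Equiv.coe_fn_mk, Set.mem_ofPred_eq]; omega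

theorem isGridSymm_mirror (a b : ℤ) : IsGridSymm (gridMirror a b) where
  aligned q p := by simp only [Aligned, gridMirror, Equiv.coe_fn_mk]; omega
  halfEdge q p x := by simp only [halfEdge, gridMirror, Equiv.coe_fn_mk, Set.mem_ofPred_eq]; omega

theorem isGridSymm_rotate (a b : ℤ) : IsGridSymm (gridRotate a b) where
  aligned q p := by simp only [Aligned, gridRotate, Equiv.coe_fn_mk]; omega
  halfEdge q p x := by simp only [halfEdge, gridRotate, Equiv.coe_fn_mk, Set.mem_ofPred_eq]; omega

theorem isGridSymm_transpose (b : ℤ) : IsGridSymm (gridTranspose b) where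
  aligned q p := by simp only [Aligned, gridTranspose, Equiv.coe_fn_mk]; omega
  halfEdge q p x := by simp only [halfEdge, gridTranspose, Equiv.coe_fn_mk, Set.mem_ofPred_eq]; omega

/-! ### Spines and their drawings -/

/-- A downward path in a binary tree, recorded by the subtrees hanging off it; the Boolean says
whether the hanging subtree is the left child. -/
abbrev Spine : Type := List (BinaryTree Unit × Bool)

/-- The tree obtained by hanging `t` below the last vertex of a spine. -/
def Spine.plug : Spine → BinaryTree Unit → BinaryTree Unit
  | [], t => t
  | (s, true) :: c, t => .node () s (Spine.plug c t)
  | (s, false) :: c, t => .node () (Spine.plug c t) s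

/-- The number of vertices of a spine together with its hanging subtrees. -/
def Spine.size (c : Spine) : ℕ := (c.map fun x => x.1.numNodes + 1).sum

theorem Spine.plug_append (c d : Spine) (t : BinaryTree Unit) :
    Spine.plug (c ++ d) t = Spine.plug c (Spine.plug d t) := by
  induction c with
  | nil => rfl
  | cons x c ih =>
    obtain ⟨s, b⟩ := x
    cases b <;> simp [Spine.plug, ih]

/-- `DrawsSpine c q S e`: the spine `c` can be drawn inside `S` with its first vertex joined to `q`
and its last vertex at `e`, so that any drawing attached at `e` and avoiding `S` can be added. -/
def DrawsSpine (c : Spine) (q : ℤ × ℤ) (S : Set (ℤ × ℤ)) (e : ℤ × ℤ) : Prop :=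
  ∀ t S', Draws t e S' → Disjoint S S' → Draws (Spine.plug c t) q (S ∪ S')

theorem DrawsSpine.mono {c q S S' e} (h : DrawsSpine c q S e) (hS : S ⊆ S') :
    DrawsSpine c q S' e := fun t _ ht hd =>
  (h t _ ht (hd.mono_left hS)).mono (Set.union_subset_union_left _ hS)

theorem DrawsSpine.append {c d q m e S S'} (hc : DrawsSpine c q S m) (hd : DrawsSpine d m S' e)
    (h : Disjoint S S') : DrawsSpine (c ++ d) q (S ∪ S') e := by
  intro t S₁ ht hdis
  rw [Set.disjoint_union_left] at hdis
  rw [Spine.plug_append, Set.union_assoc]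
  exact hc _ _ (hd _ _ ht hdis.2) (Set.disjoint_union_right.2 ⟨h, hdis.1⟩)

theorem DrawsSpine.map {φ : ℤ × ℤ ≃ ℤ × ℤ} (hφ : IsGridSymm φ) {c q S e}
    (h : DrawsSpine c q S e) : DrawsSpine c (φ q) (φ '' S) (φ e) := by
  intro t S' ht hd
  have h1 := ht.map hφ.symm
  rw [Equiv.symm_apply_apply] at h1
  have h2 := (h t _ h1 (by
    rw [← Set.disjoint_image_iff φ.injective, Equiv.image_symm_image]; exact hd)).map hφ
  rwa [Set.image_union, Equiv.image_symm_image] at h2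

theorem drawsSpine_singleton {T : BinaryTree Unit} {b : Bool} {q p : ℤ × ℤ} {S : Set (ℤ × ℤ)}
    (hal : Aligned q p) (hne : q ≠ p) (hT : Draws T p S) (hd : Disjoint (halfEdge q p) S) :
    DrawsSpine [(T, b)] q (halfEdge q p ∪ S) p := by
  intro t S' ht hdis
  rw [Set.disjoint_union_left] at hdis
  have h1 : halfEdge q p ⊆ halfEdge q p ∪ S ∪ S' := fun x hx => .inl (.inl hx)
  have h2 : S ⊆ halfEdge q p ∪ S ∪ S' := fun x hx => .inl (.inr hx)
  have h3 : S' ⊆ halfEdge q p ∪ S ∪ S' := fun x hx => .inr hx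
  cases b
  · exact .node p _ _ hal hne ht hT hdis.2.symm hdis.1 hd h1 h3 h2
  · exact .node p _ _ hal hne hT ht hdis.2 hd hdis.1 h1 h2 h3

/-! ### Fitting trees and spines into boxes -/

/-- The grid points of a `w × h` box with corner at the origin. -/
def gridBox (w h : ℕ) : Set (ℤ × ℤ) := {x | 0 ≤ x.1 ∧ x.1 < w ∧ 0 ≤ x.2 ∧ x.2 < h}

/-- The points above the origin. -/
def aboveOrigin : Set (ℤ × ℤ) := {q | q.1 = 0 ∧ q.2 < 0}

/-- The points above or to the left of the origin. -/
def outsideOrigin : Set (ℤ × ℤ) := {q | q.1 = 0 ∧ q.2 < 0 ∨ q.1 < 0 ∧ q.2 = 0}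

/-- `t` can be drawn in a `w × h` box with its root at a corner. -/
def TreeFits (w h : ℕ) (t : BinaryTree Unit) : Prop :=
  ∀ q ∈ outsideOrigin, Draws t q (halfEdge q 0 ∪ gridBox w h)

/-- `c` can be drawn in a `(W + 1) × h` box, entered at the origin from any point of `Q`, with its
last vertex in one of the extreme columns and nothing below that vertex. -/
def SpineFits (Q : Set (ℤ × ℤ)) (W h : ℕ) (c : Spine) : Prop :=
  ∃ e : ℤ × ℤ, (e.1 = 0 ∨ e.1 = W) ∧ 0 ≤ e.2 ∧ e.2 < h ∧ ∀ q ∈ Q,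
    DrawsSpine c q (halfEdge q 0 ∪ {x ∈ gridBox (W + 1) h | ¬ (x.1 = e.1 ∧ e.2 < x.2)}) e

theorem aboveOrigin_subset : aboveOrigin ⊆ outsideOrigin := fun _ h => .inl h

theorem SpineFits.mono {Q Q' W h h' c} (hc : SpineFits Q W h c) (hQ : Q' ⊆ Q) (hh : h ≤ h') :
    SpineFits Q' W h' c := by
  obtain ⟨e, h1, h2, h3, h4⟩ := hc
  refine ⟨e, h1, h2, by omega, fun q hq => (h4 q (hQ hq)).mono ?_⟩
  rintro x (hx | hx)
  · exact .inl hx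
  · right
    simp only [gridBox, Set.mem_ofPred_eq] at hx ⊢
    omega

theorem TreeFits.mono {w w' h h' t} (ht : TreeFits w h t) (hw : w ≤ w') (hh : h ≤ h') :
    TreeFits w' h' t := by
  intro q hq
  refine (ht q hq).mono ?_
  rintro x (hx | hx)
  · exact .inl hx
  · right
    simp only [gridBox, Set.mem_ofPred_eq] at hx ⊢
    omega

theorem treeFits_nil (w h : ℕ) : TreeFits w h .nil := fun _ _ => .nil _ _

theorem SpineFits.treeFits {W h c} (hc : SpineFits outsideOrigin W h c) :
    TreeFits (W + 1) h (Spine.plug c .nil) := by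
  obtain ⟨e, h1, h2, h3, h4⟩ := hc
  intro q hq
  refine (h4 q hq .nil ∅ (.nil _ _) (by simp)).mono ?_
  rintro x ((hx | hx) | hx)
  · exact .inl hx
  · exact .inr hx.1
  · exact hx.elim

/-- Transposition exchanges the two entry directions in `outsideOrigin`; this is why entry from the
left is allowed as well as from above. -/
theorem TreeFits.transpose {w h t} (ht : TreeFits w h t) : TreeFits h w t := by
  intro q hq
  have h1 := (ht (q.2, q.1) (by simp only [outsideOrigin, Set.mem_ofPred_eq] at hq ⊢; omega)).map
    (isGridSymm_transpose 0)
  have h2 : gridTranspose 0 (q.2, q.1) = q := by ext <;> simp [gridTranspose]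
  rw [h2] at h1
  refine h1.mono ?_
  rintro _ ⟨x, hx, rfl⟩
  simp only [halfEdge, gridBox, gridTranspose, Equiv.coe_fn_mk, Set.mem_ofPred_eq, Set.mem_union,
    Prod.fst_zero, Prod.snd_zero] at hx ⊢
  omega

/-- The column below the exit of `c` is free, so `d` is stacked underneath and entered vertically
through that column. It is mirrored when the exit is in the last column. -/
theorem SpineFits.append {Q W h h' c d} (hQ : ∀ q ∈ Q, q.2 ≤ 0) (hc : SpineFits Q W h c)
    (hd : SpineFits aboveOrigin W h' d) : SpineFits Q W (h + h') (c ++ d) := by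
  obtain ⟨e, h1, h2, h3, h4⟩ := hc
  obtain ⟨f, g1, g2, g3, g4⟩ := hd
  have g5 := g4 (0, e.2 - h) ⟨rfl, by simp only; omega⟩
  rcases h1 with h1 | h1
  · have g6 := g5.map (isGridSymm_translate 0 h)
    have h5 : gridTranslate 0 h (0, e.2 - h) = e := by ext <;> simp [gridTranslate, h1]
    rw [h5] at g6
    refine ⟨_, ?_, ?_, ?_, fun q hq => ((h4 q hq).append g6 ?_).mono ?_⟩
    · simp only [gridTranslate, Equiv.coe_fn_mk]; omega
    · simp only [gridTranslate, Equiv.coe_fn_mk]; omega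
    · simp only [gridTranslate, Equiv.coe_fn_mk]; omega
    · have := hQ q hq
      rw [Set.disjoint_left]
      rintro _ hy ⟨x, hx, rfl⟩
      simp only [halfEdge, gridBox, gridTranslate, Equiv.coe_fn_mk, Set.mem_ofPred_eq,
        Set.mem_union, Prod.fst_zero, Prod.snd_zero] at hx hy
      omega
    · rintro _ (hy | ⟨x, hx, rfl⟩)
      · simp only [halfEdge, gridBox, gridTranslate, Equiv.coe_fn_mk, Set.mem_ofPred_eq,
          Set.mem_union, Prod.fst_zero, Prod.snd_zero] at hy ⊢
        omega
      · simp only [halfEdge, gridBox, gridTranslate, Equiv.coe_fn_mk, Set.mem_ofPred_eq,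
          Set.mem_union, Prod.fst_zero, Prod.snd_zero] at hx ⊢
        omega
  · have g6 := g5.map (isGridSymm_mirror W h)
    have h5 : gridMirror W h (0, e.2 - h) = e := by ext <;> simp [gridMirror, h1]
    rw [h5] at g6
    refine ⟨_, ?_, ?_, ?_, fun q hq => ((h4 q hq).append g6 ?_).mono ?_⟩
    · simp only [gridMirror, Equiv.coe_fn_mk]; omega
    · simp only [gridMirror, Equiv.coe_fn_mk]; omega
    · simp only [gridMirror, Equiv.coe_fn_mk]; omega
    · have := hQ q hq
      rw [Set.disjoint_left]
      rintro _ hy ⟨x, hx, rfl⟩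
      simp only [halfEdge, gridBox, gridMirror, Equiv.coe_fn_mk, Set.mem_ofPred_eq,
        Set.mem_union, Prod.fst_zero, Prod.snd_zero] at hx hy
      omega
    · rintro _ (hy | ⟨x, hx, rfl⟩)
      · simp only [halfEdge, gridBox, gridMirror, Equiv.coe_fn_mk, Set.mem_ofPred_eq,
          Set.mem_union, Prod.fst_zero, Prod.snd_zero] at hy ⊢
        omega
      · simp only [halfEdge, gridBox, gridMirror, Equiv.coe_fn_mk, Set.mem_ofPred_eq,
          Set.mem_union, Prod.fst_zero, Prod.snd_zero] at hx ⊢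
        omega

theorem spineFits_singleton {W h T} (b : Bool) (hT : TreeFits W h T) (hW : 1 ≤ W) (hh : 1 ≤ h) :
    SpineFits outsideOrigin W h [(T, b)] := by
  refine ⟨0, by simp, by simp, by simp; omega, fun q hq => ?_⟩
  -- Column `0` is reserved for the spine vertex; its subtree starts one column to the right and is
  -- entered from the left.
  have h1 := (hT (-1, 0) (by simp [outsideOrigin])).map (isGridSymm_translate 1 0)
  have h2 : gridTranslate 1 0 (-1, 0) = 0 := by ext <;> simp [gridTranslate]
  rw [h2] at h1
  simp only [outsideOrigin, Set.mem_ofPred_eq] at hq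
  refine (drawsSpine_singleton (p := 0) ?_ ?_ h1 ?_).mono ?_
  · simp only [Aligned, Prod.fst_zero, Prod.snd_zero]; omega
  · rintro rfl; simp at hq
  · rw [Set.disjoint_left]
    rintro _ hy ⟨x, hx, rfl⟩
    simp only [halfEdge, gridBox, gridTranslate, Equiv.coe_fn_mk, Set.mem_ofPred_eq,
        Set.mem_union, Prod.fst_zero, Prod.snd_zero] at hx hy
    omega
  · rintro _ (hy | ⟨x, hx, rfl⟩)
    · exact .inl hy
    · right
      simp only [halfEdge, gridBox, gridTranslate, Equiv.coe_fn_mk, Set.mem_ofPred_eq,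
          Set.mem_union, Prod.fst_zero, Prod.snd_zero] at hx ⊢
      omega

/-- The winding step: a spine of small height, laid out sideways, followed by a turning vertex. -/
theorem SpineFits.snoc {W W' w h D T} (b : Bool) (hD : SpineFits outsideOrigin W' w D)
    (hT : TreeFits W h T) (hw : w ≤ W) (hh : 1 ≤ h) :
    SpineFits aboveOrigin W (h + (W' + 1)) (D ++ [(T, b)]) := by
  obtain ⟨e, h1, h2, h3, h4⟩ := hD
  -- The rotated `T` takes columns `1` to `W` of the top `h` rows, leaving column `0` for the
  -- incoming edge. The transposed `D` lies below, in columns smaller than `w ≤ W`. Its exit has a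
  -- free row to the right, which leads to the turning vertex `u` in column `W`, under the root of
  -- `T`.
  have hu : ∃ u : ℤ × ℤ, u = ((W : ℤ), e.1 + h) := ⟨_, rfl⟩
  obtain ⟨u, hu⟩ := hu
  have hu1 : u.1 = W := by rw [hu]
  have hu2 : u.2 = e.1 + h := by rw [hu]
  have t1 := (hT (0, - e.1 - 1) (.inl ⟨rfl, by simp only; omega⟩)).map
    (isGridSymm_rotate W (h - 1))
  have t2 : gridRotate W (h - 1) (0, - e.1 - 1) = u := by
    ext <;> simp only [gridRotate, Equiv.coe_fn_mk] <;> omega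
  rw [t2] at t1
  refine ⟨u, by omega, by omega, by push_cast; omega, fun q hq => ?_⟩
  simp only [aboveOrigin, Set.mem_ofPred_eq] at hq
  have d1 := (h4 (q.2 - h, q.1) (by simp only [outsideOrigin, Set.mem_ofPred_eq]; omega)).map
    (isGridSymm_transpose h)
  have d2 : gridTranspose h (q.2 - h, q.1) = q := by
    ext
    · simp only [gridTranspose, Equiv.coe_fn_mk]
    · simp only [gridTranspose, Equiv.coe_fn_mk]; omega
  rw [d2] at d1
  have e1 : (gridTranspose h e).1 = e.2 := rfl
  have e2 : (gridTranspose h e).2 = e.1 + h := rfl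
  generalize gridTranspose h e = f at d1 e1 e2
  refine (d1.append (drawsSpine_singleton (p := u) ?_ ?_ t1 ?_) ?_).mono ?_
  · simp only [Aligned]; omega
  · rintro rfl; omega
  · rw [Set.disjoint_left]
    rintro _ hy ⟨x, hx, rfl⟩
    simp only [halfEdge, gridBox, gridRotate, Equiv.coe_fn_mk, Set.mem_ofPred_eq,
        Set.mem_union, Prod.fst_zero, Prod.snd_zero] at hx hy
    omega
  · rw [Set.disjoint_left]
    rintro _ ⟨x, hx, rfl⟩ (hy | ⟨y, hy, hxy⟩)
    · simp only [halfEdge, gridBox, gridTranspose, Equiv.coe_fn_mk, Set.mem_ofPred_eq,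
        Set.mem_union, Prod.fst_zero, Prod.snd_zero] at hx hy
      omega
    · simp only [halfEdge, gridBox, gridTranspose, gridRotate, Equiv.coe_fn_mk, Set.mem_ofPred_eq,
        Set.mem_union, Prod.fst_zero, Prod.snd_zero, Prod.mk.injEq] at hx hy hxy
      omega
  · rintro _ (⟨x, hx, rfl⟩ | hy | ⟨x, hx, rfl⟩)
    · simp only [halfEdge, gridBox, gridTranspose, Equiv.coe_fn_mk, Set.mem_ofPred_eq,
        Set.mem_union, Prod.fst_zero, Prod.snd_zero] at hx ⊢
      omega
    · simp only [halfEdge, gridBox, Set.mem_ofPred_eq,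
        Set.mem_union, Prod.fst_zero, Prod.snd_zero] at hy ⊢
      omega
    · simp only [halfEdge, gridBox, gridRotate, Equiv.coe_fn_mk, Set.mem_ofPred_eq,
        Set.mem_union, Prod.fst_zero, Prod.snd_zero] at hx ⊢
      omega

/-! ### Weights and heavy paths -/

/-- Size of a spine in which large hanging subtrees are charged differently from small ones. -/
def Spine.weight (B : ℕ) (c : Spine) : ℕ :=
  (c.map fun x => if x.1.numNodes ≤ B then 2 * (x.1.numNodes + 1) else 7 * x.1.numNodes).sum

@[simp] theorem Spine.size_nil : Spine.size [] = 0 := rfl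

@[simp] theorem Spine.size_cons (x : BinaryTree Unit × Bool) (c : Spine) :
    Spine.size (x :: c) = x.1.numNodes + 1 + Spine.size c := by simp [Spine.size]

@[simp] theorem Spine.size_append (c d : Spine) :
    Spine.size (c ++ d) = Spine.size c + Spine.size d := by simp [Spine.size]

@[simp] theorem Spine.weight_nil (B : ℕ) : Spine.weight B [] = 0 := rfl

@[simp] theorem Spine.weight_cons (B : ℕ) (x : BinaryTree Unit × Bool) (c : Spine) :
    Spine.weight B (x :: c) = (if x.1.numNodes ≤ B then 2 * (x.1.numNodes + 1)
      else 7 * x.1.numNodes) + Spine.weight B c := by simp [Spine.weight]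

@[simp] theorem Spine.weight_append (B : ℕ) (c d : Spine) :
    Spine.weight B (c ++ d) = Spine.weight B c + Spine.weight B d := by simp [Spine.weight]

theorem Spine.weight_le (B : ℕ) (c : Spine) : Spine.weight B c ≤ 7 * Spine.size c := by
  induction c with
  | nil => simp
  | cons x c ih =>
    simp only [weight_cons, size_cons]
    split_ifs <;> omega

theorem Spine.le_weight {B : ℕ} (hB : 1 ≤ B) (c : Spine) :
    2 * Spine.size c ≤ Spine.weight B c := by
  induction c with
  | nil => simp
  | cons x c ih =>
    simp only [weight_cons, size_cons]
    split_ifs <;> omega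

theorem Spine.weight_eq_of_forall_le {B : ℕ} (c : Spine) (h : ∀ x ∈ c, x.1.numNodes ≤ B) :
    Spine.weight B c = 2 * Spine.size c := by
  induction c with
  | nil => simp
  | cons x c ih =>
    rw [weight_cons, size_cons, ih fun y hy => h y (List.mem_cons_of_mem _ hy),
      if_pos (h x List.mem_cons_self)]
    omega

theorem Spine.numNodes_plug (c : Spine) (t : BinaryTree Unit) :
    (Spine.plug c t).numNodes = Spine.size c + t.numNodes := by
  induction c with
  | nil => simp [plug]
  | cons x c ih =>
    obtain ⟨s, b⟩ := x
    cases b <;> simp [plug, ih] <;> omega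

/-- Every nonempty tree is the spine of its heavy path. -/
theorem exists_heavy_spine (t : BinaryTree Unit) (ht : t ≠ .nil) :
    ∃ c : Spine, c ≠ [] ∧ Spine.plug c .nil = t ∧ (∀ x ∈ c, 2 * x.1.numNodes < t.numNodes) ∧
      ∀ B, B < t.numNodes → Spine.weight B c + 5 * B ≤ 7 * t.numNodes := by
  have key : ∀ (s h : BinaryTree Unit) (b : Bool), s.numNodes ≤ h.numNodes →
      (h ≠ .nil → ∃ c : Spine, c ≠ [] ∧ Spine.plug c .nil = h ∧
        (∀ x ∈ c, 2 * x.1.numNodes < h.numNodes) ∧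
        ∀ B, B < h.numNodes → Spine.weight B c + 5 * B ≤ 7 * h.numNodes) →
      ∃ c : Spine, c ≠ [] ∧ Spine.plug c .nil = Spine.plug [(s, b)] h ∧
        (∀ x ∈ c, 2 * x.1.numNodes < s.numNodes + h.numNodes + 1) ∧
        ∀ B, B < s.numNodes + h.numNodes + 1 →
          Spine.weight B c + 5 * B ≤ 7 * (s.numNodes + h.numNodes + 1) := by
    intro s h b hsh ih
    by_cases hh : h = .nil
    · subst hh
      simp only [BinaryTree.numNodes] at hsh ⊢
      refine ⟨[(s, b)], by simp, rfl, ?_, ?_⟩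
      · simp; omega
      · intro B hB
        simp only [Spine.weight_cons, Spine.weight_nil]
        split_ifs <;> omega
    · obtain ⟨c, -, h2, h3, h4⟩ := ih hh
      refine ⟨(s, b) :: c, by simp, ?_, ?_, ?_⟩
      · rw [← h2, ← Spine.plug_append]; rfl
      · intro x hx
        rcases List.mem_cons.1 hx with rfl | hx
        · simp only; omega
        · have := h3 x hx; omega
      · intro B hB
        by_cases hBh : B < h.numNodes
        · have := h4 B hBh
          simp only [Spine.weight_cons]
          split_ifs <;> omega
        -- Once the heavy child has size at most `B`, every hanging subtree from here on is small,
        -- so the rate is `2` instead of `7`. As the whole tree is larger than `B`, this saves at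
        -- least `5 * B`.
        · have h5 := Spine.weight_eq_of_forall_le (B := B) c fun x hx => by
            have := h3 x hx; omega
          have h6 := Spine.numNodes_plug c .nil
          rw [h2] at h6
          simp only [BinaryTree.numNodes] at h6
          simp only [Spine.weight_cons]
          split_ifs <;> omega
  induction t with
  | nil => exact absurd rfl ht
  | node a l r ihl ihr =>
    rcases le_total l.numNodes r.numNodes with h | h
    · obtain ⟨c, h1, h2, h3, h4⟩ := key l r true h ihr
      exact ⟨c, h1, h2, h3, h4⟩
    · obtain ⟨c, h1, h2, h3, h4⟩ := key r l false h ihl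
      simp only [BinaryTree.numNodes, add_comm l.numNodes]
      exact ⟨c, h1, h2, h3, h4⟩

/-! ### Winding a long spine -/

/-- All spines of size at most `B` fit into a `(W' + 1) × w` box. -/
def SmallSpinesFit (B W' w : ℕ) : Prop :=
  ∀ c : Spine, c ≠ [] → c.size ≤ B → SpineFits outsideOrigin W' w c

/-- The height budget for a tree of size `n`. -/
def HeightBudget (L B n h : ℕ) : Prop :=
  1 ≤ h ∧ (n ≤ B → h = L) ∧ (B < n → h * B + L * B ≤ L * (7 * n))

section Winding

variable {B W' w W : ℕ} (hyp : SmallSpinesFit B W' w) (hw : w ≤ W) (hW : 1 ≤ W) (hB : 1 ≤ B)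

include hyp hw hW

/-- The block `D` laid sideways costs `W' + 1` rows. If the subtree of `x` is large, the reserve `L
* B` in `HeightBudget` pays for them; if it is small, it needs another `W' + 1` rows. -/
theorem exists_spineFits_unit {D : Spine} (hD : D.size ≤ B) (x : BinaryTree Unit × Bool)
    (hx : ∃ h, TreeFits W h x.1 ∧ HeightBudget (W' + 1) B x.1.numNodes h) :
    ∃ h, SpineFits aboveOrigin W h (D ++ [x]) ∧
      h * B ≤ (W' + 1) * (if x.1.numNodes ≤ B then 2 * B else 7 * x.1.numNodes) := by
  obtain ⟨h, h1, h2, h3, h4⟩ := hx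
  obtain ⟨T, b⟩ := x
  refine ⟨h + (W' + 1), ?_, ?_⟩
  · by_cases hD0 : D = []
    · subst hD0
      exact (spineFits_singleton b h1 hW h2).mono aboveOrigin_subset (by omega)
    · exact (hyp D hD0 hD).snoc b h1 hw h2
  · split_ifs with hs
    · rw [h3 hs]; exact le_of_eq (by ring)
    · linarith [h4 (by omega)]

include hB

/-- Greedy blocks: `D` is the current block, closed only when the next vertex would push it beyond
`B`. If that vertex has a small subtree, the unit has weight above `2 * B`, which pays for its
height; a large subtree pays by itself. Only the last unit may be unpaid, hence the extra `2 * B`.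
-/
theorem exists_spineFits_winding (c : Spine) (hc : c ≠ [])
    (hx : ∀ x ∈ c, ∃ h, TreeFits W h x.1 ∧ HeightBudget (W' + 1) B x.1.numNodes h) :
    ∀ D : Spine, D.size ≤ B → ∃ h, SpineFits aboveOrigin W h (D ++ c) ∧
      h * B ≤ (W' + 1) * (D.weight B + c.weight B + 2 * B) := by
  induction c with
  | nil => exact absurd rfl hc
  | cons x c ih =>
    intro D hD
    obtain ⟨h, h1, h2⟩ := exists_spineFits_unit hyp hw hW hD x (hx x List.mem_cons_self)
    by_cases hc0 : c = []
    · subst hc0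
      refine ⟨h, h1, h2.trans (Nat.mul_le_mul_left _ ?_)⟩
      simp only [Spine.weight_cons]
      split_ifs <;> omega
    · have hx' := fun y hy => hx y (List.mem_cons_of_mem _ hy)
      by_cases hs : D.size + (x.1.numNodes + 1) ≤ B
      · obtain ⟨h, h1, h2⟩ := ih hc0 hx' (D ++ [x]) (by simpa using hs)
        refine ⟨h, by simpa using h1, h2.trans (le_of_eq ?_)⟩
        simp only [Spine.weight_cons, Spine.weight_append, Spine.weight_nil]
        ring
      · obtain ⟨h', h1', h2'⟩ := ih hc0 hx' [] (by simp)
        refine ⟨h + h', ?_, ?_⟩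
        · have := h1.append (fun q hq => hq.2.le) h1'
          simpa using this
        · rw [add_mul]
          refine (add_le_add h2 h2').trans ?_
          rw [← mul_add]
          refine Nat.mul_le_mul_left _ ?_
          have := Spine.le_weight hB D
          simp only [Spine.weight_cons, Spine.weight_nil]
          split_ifs <;> omega

/-- Winding units can be entered only from above. Placing the first vertex separately restores entry
from the left, at the price of another `2 * B`. -/
theorem exists_spineFits_of_trees (c : Spine) (hc : c ≠ [])
    (hx : ∀ x ∈ c, ∃ h, TreeFits W h x.1 ∧ HeightBudget (W' + 1) B x.1.numNodes h) :
    ∃ h, SpineFits outsideOrigin W h c ∧ h * B ≤ (W' + 1) * (c.weight B + 4 * B) := by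
  have hQ : ∀ q ∈ outsideOrigin, q.2 ≤ 0 := by
    rintro q (⟨-, h⟩ | ⟨-, h⟩) <;> omega
  cases c with
  | nil => exact absurd rfl hc
  | cons x c =>
    obtain ⟨h, h1, h2, h3, h4⟩ := hx x List.mem_cons_self
    have hs := spineFits_singleton x.2 h1 hW h2
    have hb : h * B ≤ (W' + 1) * (Spine.weight B [x] + 2 * B) := by
      simp only [Spine.weight_cons, Spine.weight_nil]
      split_ifs with hs
      · rw [h3 hs]; exact Nat.mul_le_mul_left _ (by omega)
      · refine le_trans ?_ (Nat.mul_le_mul_left (W' + 1)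
          (show 7 * x.1.numNodes ≤ 7 * x.1.numNodes + 0 + 2 * B by omega))
        exact (Nat.le_add_right _ _).trans (h4 (by omega))
    by_cases hc0 : c = []
    · subst hc0
      exact ⟨h, hs, hb.trans (Nat.mul_le_mul_left _ (by omega))⟩
    · obtain ⟨h', h1', h2'⟩ := exists_spineFits_winding hyp hw hW hB c hc0
        (fun y hy => hx y (List.mem_cons_of_mem _ hy)) [] (by simp)
      refine ⟨h + h', hs.append hQ h1', ?_⟩
      rw [add_mul]
      refine (add_le_add hb h2').trans ?_
      rw [← mul_add]
      refine Nat.mul_le_mul_left _ ?_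
      simp only [Spine.weight_cons, Spine.weight_nil]
      omega

end Winding

theorem SmallSpinesFit.treeFits {B W' w : ℕ} (hyp : SmallSpinesFit B W' w)
    {t : BinaryTree Unit} (ht : t.numNodes ≤ B) : TreeFits w (W' + 1) t := by
  by_cases h0 : t = .nil
  · subst h0; exact treeFits_nil _ _
  · obtain ⟨c, h1, h2, -⟩ := exists_heavy_spine t h0
    have h3 := Spine.numNodes_plug c .nil
    rw [h2] at h3
    simp only [BinaryTree.numNodes] at h3
    rw [← h2]
    exact (hyp c h1 (by omega)).treeFits.transpose

/-- Subtrees hanging off the heavy path have less than half the size, and each level of recursion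
adds one column. -/
theorem exists_treeFits {B W' w : ℕ} (hyp : SmallSpinesFit B W' w) (hw : 1 ≤ w) (hB : 1 ≤ B)
    (j : ℕ) (t : BinaryTree Unit) (ht : t.numNodes < 2 ^ j) :
    ∃ h, TreeFits (w + j) h t ∧ HeightBudget (W' + 1) B t.numNodes h := by
  induction j generalizing t with
  | zero =>
    have : t.numNodes = 0 := by simpa using ht
    exact ⟨W' + 1, (hyp.treeFits (by omega)).mono (by omega) le_rfl, by omega, fun _ => rfl,
      fun h => by omega⟩
  | succ j ih =>
    by_cases hs : t.numNodes ≤ B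
    · exact ⟨W' + 1, (hyp.treeFits hs).mono (by omega) le_rfl, by omega, fun _ => rfl,
        fun h => by omega⟩
    · have h0 : t ≠ .nil := by rintro rfl; simp at hs
      obtain ⟨c, h1, h2, h3, h4⟩ := exists_heavy_spine t h0
      obtain ⟨h, h5, h6⟩ := exists_spineFits_of_trees hyp (W := w + j) (by omega) (by omega) hB c h1
        (fun x hx => ih _ (by have := h3 x hx; rw [pow_succ] at ht; omega))
      have h7 := h5.treeFits
      rw [h2] at h7
      have hpos : 1 ≤ h := by
        obtain ⟨e, -, g1, g2, -⟩ := h5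
        omega
      refine ⟨h, h7, hpos, fun h => absurd h hs, fun _ => ?_⟩
      -- The saving `5 * B` from the heavy path covers the winding overhead `4 * B` and renews the
      -- reserve of one `B`, so the budget does not deteriorate with depth.
      calc h * B + (W' + 1) * B ≤ (W' + 1) * (c.weight B + 4 * B) + (W' + 1) * B := by gcongr
        _ = (W' + 1) * (c.weight B + 5 * B) := by ring
        _ ≤ _ := Nat.mul_le_mul_left _ (h4 B (by omega))

/-- Passing from short spines in one orientation to long spines in the other. -/
theorem exists_spineFits {B W' w : ℕ} (hyp : SmallSpinesFit B W' w) (hw : 1 ≤ w) (hB : 1 ≤ B)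
    {j W : ℕ} (hW : w + j ≤ W) (c : Spine) (hc : c ≠ []) (hj : c.size ≤ 2 ^ j) :
    ∃ h, SpineFits outsideOrigin W h c ∧ h * B ≤ (W' + 1) * (7 * c.size + 4 * B) := by
  obtain ⟨h, h1, h2⟩ := exists_spineFits_of_trees hyp (by omega) (by omega) hB c hc
    (W := W) fun x hx => by
      have h3 : x.1.numNodes + 1 ≤ c.size := by
        rw [Spine.size]
        exact List.le_sum_of_mem (List.mem_map_of_mem (f := fun x => x.1.numNodes + 1) hx)
      obtain ⟨h, h4, h5⟩ := exists_treeFits hyp hw hB j x.1 (by omega)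
      exact ⟨h, h4.mono hW le_rfl, h5⟩
  exact ⟨h, h1, h2.trans (Nat.mul_le_mul_left _ (by have := c.weight_le B; omega))⟩

theorem smallSpinesFit_one : SmallSpinesFit 1 1 1 := by
  intro c hc hs
  cases c with
  | nil => exact absurd rfl hc
  | cons x c =>
    obtain ⟨T, b⟩ := x
    simp only [Spine.size_cons] at hs
    have hT : T = .nil := by
      cases T with
      | nil => rfl
      | node => simp only [BinaryTree.numNodes] at hs; omega
    have hc' : c = [] := by
      cases c with
      | nil => rfl
      | cons => simp only [Spine.size_cons] at hs; omega
    subst hT hc'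
    exact spineFits_singleton b (treeFits_nil _ _) le_rfl le_rfl

/-! ### From lattice drawings to straight-line drawings -/

/-- The position of the parent of the vertex `v`, where the root has the virtual parent `q`. -/
def parentPos (q : ℤ × ℤ) (pos : List Bool → ℤ × ℤ) (v : List Bool) : ℤ × ℤ :=
  if v = [] then q else pos v.dropLast

theorem parentPos_concat (q : ℤ × ℤ) (pos : List Bool → ℤ × ℤ) (v : List Bool) (b : Bool) :
    parentPos q pos (v ++ [b]) = pos v := by simp [parentPos]

theorem right_mem_halfEdge {q p : ℤ × ℤ} (h : q ≠ p) : p ∈ halfEdge q p := by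
  refine ⟨fun ⟨h1, h2⟩ => h (Prod.ext h1.symm h2.symm), ?_⟩
  omega

/-- The coordinates of a drawing. -/
theorem Draws.exists_pos {t q S} (h : Draws t q S) :
    ∃ pos : List Bool → ℤ × ℤ,
      (∀ v, IsVertex t v → Aligned (parentPos q pos v) (pos v) ∧ parentPos q pos v ≠ pos v ∧
        halfEdge (parentPos q pos v) (pos v) ⊆ S) ∧
      ∀ v v', IsVertex t v → IsVertex t v' → v ≠ v' →
        Disjoint (halfEdge (parentPos q pos v) (pos v))
          (halfEdge (parentPos q pos v') (pos v')) := by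
  induction h with
  | nil => exact ⟨fun _ => 0, fun v hv => hv.elim, fun v _ hv => hv.elim⟩
  | @node l r q S p Sl Sr hal hne hl hr hlr hpl hpr h1 h2 h3 ihl ihr =>
    obtain ⟨posl, l1, l2⟩ := ihl
    obtain ⟨posr, r1, r2⟩ := ihr
    have hpos : ∃ pos : List Bool → ℤ × ℤ, pos [] = p ∧ (∀ v, pos (false :: v) = posl v) ∧
        ∀ v, pos (true :: v) = posr v :=
      ⟨fun v => match v with
        | [] => p
        | false :: v => posl v
        | true :: v => posr v, rfl, fun _ => rfl, fun _ => rfl⟩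
    obtain ⟨pos, e0, el, er⟩ := hpos
    have f0 : parentPos q pos [] = q := rfl
    have fl : ∀ v, parentPos q pos (false :: v) = parentPos p posl v := by
      intro v
      cases v with
      | nil => simp [parentPos, e0]
      | cons b v => simp [parentPos, el]
    have fr : ∀ v, parentPos q pos (true :: v) = parentPos p posr v := by
      intro v
      cases v with
      | nil => simp [parentPos, e0]
      | cons b v => simp [parentPos, er]
    refine ⟨pos, ?_, ?_⟩
    · rintro (_ | ⟨_ | _, v⟩) hv
      · rw [f0, e0]; exact ⟨hal, hne, h1⟩
      · rw [fl, el]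
        obtain ⟨a1, a2, a3⟩ := l1 v hv
        exact ⟨a1, a2, a3.trans h2⟩
      · rw [fr, er]
        obtain ⟨a1, a2, a3⟩ := r1 v hv
        exact ⟨a1, a2, a3.trans h3⟩
    · rintro (_ | ⟨_ | _, v⟩) (_ | ⟨_ | _, v'⟩) hv hv' hvv
      · exact absurd rfl hvv
      · rw [f0, e0, fl, el]; exact hpl.mono_right (l1 v' hv').2.2
      · rw [f0, e0, fr, er]; exact hpr.mono_right (r1 v' hv').2.2
      · rw [f0, e0, fl, el]; exact (hpl.mono_right (l1 v hv).2.2).symm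
      · rw [fl, el, fl, el]; exact l2 v v' hv hv' (fun h => hvv (by rw [h]))
      · rw [fl, el, fr, er]; exact hlr.mono (l1 v hv).2.2 (r1 v' hv').2.2
      · rw [f0, e0, fr, er]; exact (hpr.mono_right (r1 v hv).2.2).symm
      · rw [fl, el, fr, er]; exact (hlr.mono (l1 v' hv').2.2 (r1 v hv).2.2).symm
      · rw [fr, er, fr, er]; exact r2 v v' hv hv' (fun h => hvv (by rw [h]))

/-- The grid points of the closed segment between two aligned points. -/
def gridEdge (q p : ℤ × ℤ) : Set (ℤ × ℤ) :=
  {x | min q.1 p.1 ≤ x.1 ∧ x.1 ≤ max q.1 p.1 ∧ min q.2 p.2 ≤ x.2 ∧ x.2 ≤ max q.2 p.2}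

theorem gridEdge_comm (q p : ℤ × ℤ) : gridEdge q p = gridEdge p q := by
  simp only [gridEdge, min_comm, max_comm]

theorem mem_gridEdge_iff {q p x : ℤ × ℤ} : x ∈ gridEdge q p ↔ x = q ∨ x ∈ halfEdge q p := by
  rw [Prod.ext_iff]
  simp only [gridEdge, halfEdge, Set.mem_ofPred_eq]
  omega

/-- The real points of an orthogonal segment. -/
theorem segment_gridPoint_subset {q p : ℤ × ℤ} {x : ℝ × ℝ}
    (hx : x ∈ segment ℝ (gridPoint q) (gridPoint p)) :
    ((min q.1 p.1 : ℤ) : ℝ) ≤ x.1 ∧ x.1 ≤ ((max q.1 p.1 : ℤ) : ℝ) ∧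
      ((min q.2 p.2 : ℤ) : ℝ) ≤ x.2 ∧ x.2 ≤ ((max q.2 p.2 : ℤ) : ℝ) := by
  obtain ⟨a, b, ha, hb, hab, rfl⟩ := hx
  have hb' : b = 1 - a := by linarith
  subst hb'
  simp only [gridPoint, Prod.smul_mk, smul_eq_mul, Prod.mk_add_mk, Int.cast_min, Int.cast_max]
  have key : ∀ u v : ℝ, min u v ≤ a * u + (1 - a) * v ∧ a * u + (1 - a) * v ≤ max u v := by
    intro u v
    constructor
    · nlinarith [min_le_left u v, min_le_right u v]
    · nlinarith [le_max_left u v, le_max_right u v]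
  exact ⟨(key _ _).1, (key _ _).2, (key _ _).1, (key _ _).2⟩

theorem floor_mem_gridEdge {q p : ℤ × ℤ} {x : ℝ × ℝ}
    (hx : x ∈ segment ℝ (gridPoint q) (gridPoint p)) : (⌊x.1⌋, ⌊x.2⌋) ∈ gridEdge q p := by
  obtain ⟨h1, h2, h3, h4⟩ := segment_gridPoint_subset hx
  exact ⟨Int.le_floor.2 h1, Int.cast_le.1 ((Int.floor_le _).trans h2), Int.le_floor.2 h3,
    Int.cast_le.1 ((Int.floor_le _).trans h4)⟩

theorem ceil_mem_gridEdge {q p : ℤ × ℤ} {x : ℝ × ℝ}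
    (hx : x ∈ segment ℝ (gridPoint q) (gridPoint p)) : (⌈x.1⌉, ⌈x.2⌉) ∈ gridEdge q p := by
  obtain ⟨h1, h2, h3, h4⟩ := segment_gridPoint_subset hx
  exact ⟨Int.cast_le.1 (h1.trans (Int.le_ceil _)), Int.ceil_le.2 h2,
    Int.cast_le.1 (h3.trans (Int.le_ceil _)), Int.ceil_le.2 h4⟩

theorem eq_gridPoint_of_floor_eq_ceil {x : ℝ × ℝ}
    (h : ((⌊x.1⌋, ⌊x.2⌋) : ℤ × ℤ) = (⌈x.1⌉, ⌈x.2⌉)) : x = gridPoint (⌊x.1⌋, ⌊x.2⌋) := by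
  rw [Prod.mk.injEq] at h
  ext
  · refine le_antisymm ?_ (Int.floor_le _)
    have := Int.le_ceil x.1
    rwa [← h.1] at this
  · refine le_antisymm ?_ (Int.floor_le _)
    have := Int.le_ceil x.2
    rwa [← h.2] at this

theorem exists_edge_of_adj {t : BinaryTree Unit} {u v : Vertex t} (h : (treeGraph t).Adj u v) :
    ∃ a c : Vertex t, (∃ b, c.1 = a.1 ++ [b]) ∧ (u = a ∧ v = c ∨ u = c ∧ v = a) := by
  rcases h with h | h
  · exact ⟨u, v, h, .inl ⟨rfl, rfl⟩⟩
  · exact ⟨v, u, h, .inr ⟨rfl, rfl⟩⟩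

theorem isStraightLineOrthogonalDrawing_of_draws {t : BinaryTree Unit} {W H : ℕ}
    (h : Draws t (0, -1) (gridBox W H)) :
    ∃ pos : Vertex t → ℤ × ℤ, IsStraightLineOrthogonalDrawing (treeGraph t) W H pos := by
  obtain ⟨pos₀, h1, h2⟩ := (h.map (isGridSymm_translate 1 1)).exists_pos
  generalize gridTranslate 1 1 (0, -1) = q at h1 h2
  have hpos : ∃ pos : Vertex t → ℤ × ℤ, ∀ v, pos v = pos₀ v.1 := ⟨_, fun _ => rfl⟩
  obtain ⟨pos, hpos⟩ := hpos
  have hE : ∃ E : Vertex t → Set (ℤ × ℤ), ∀ v, E v = halfEdge (parentPos q pos₀ v.1) (pos v) :=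
    ⟨_, fun _ => rfl⟩
  obtain ⟨E, hE⟩ := hE
  have hmem : ∀ v, pos v ∈ E v := fun v => by
    rw [hE, hpos]; exact right_mem_halfEdge (h1 v.1 v.2).2.1
  have huniq : ∀ {v w x}, x ∈ E v → x ∈ E w → v = w := by
    intro v w x hv hw
    by_contra hne
    rw [hE, hpos] at hv hw
    exact Set.disjoint_left.1 (h2 v.1 w.1 v.2 w.2 fun h => hne (Subtype.ext h)) hv hw
  have hinj : Function.Injective pos := fun v w hvw => huniq (hmem v) (hvw ▸ hmem w)
  have hpar : ∀ {a c : Vertex t}, (∃ b, c.1 = a.1 ++ [b]) → parentPos q pos₀ c.1 = pos a := by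
    rintro a c ⟨b, hb⟩
    rw [hb, parentPos_concat, hpos]
  have hedge : ∀ {a c : Vertex t} {x}, (∃ b, c.1 = a.1 ++ [b]) →
      x ∈ gridEdge (pos a) (pos c) → x = pos a ∨ x ∈ E c := by
    intro a c x hac hx
    rwa [hE, hpar hac, ← mem_gridEdge_iff]
  have avoid : ∀ {a c w : Vertex t}, (∃ b, c.1 = a.1 ++ [b]) →
      pos w ∈ gridEdge (pos a) (pos c) → w = a ∨ w = c := by
    intro a c w hac hw
    rcases hedge hac hw with h | h
    · exact .inl (hinj h)
    · exact .inr (huniq (hmem w) h)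
  have cross : ∀ {a c a' c' : Vertex t} {x}, (∃ b, c.1 = a.1 ++ [b]) → (∃ b, c'.1 = a'.1 ++ [b]) →
      c ≠ c' → x ∈ gridEdge (pos a) (pos c) → x ∈ gridEdge (pos a') (pos c') →
      ∃ w, (w = a ∨ w = c) ∧ (w = a' ∨ w = c') ∧ x = pos w := by
    intro a c a' c' x hac hac' hne hx hx'
    rcases hedge hac hx with rfl | h
    · exact ⟨a, .inl rfl, avoid hac' hx', rfl⟩
    · rcases hedge hac' hx' with rfl | h'
      · exact ⟨a', avoid hac hx, .inl rfl, rfl⟩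
      · exact absurd (huniq h h') hne
  have cross' : ∀ {u v u' v' : Vertex t} {x}, (treeGraph t).Adj u v → (treeGraph t).Adj u' v' →
      s(u, v) ≠ s(u', v') → x ∈ gridEdge (pos u) (pos v) → x ∈ gridEdge (pos u') (pos v') →
      ∃ w, (w = u ∨ w = v) ∧ (w = u' ∨ w = v') ∧ x = pos w := by
    intro u v u' v' x huv huv' hne hx hx'
    obtain ⟨a, c, hac, h⟩ := exists_edge_of_adj huv
    obtain ⟨a', c', hac', h'⟩ := exists_edge_of_adj huv'
    -- An edge is determined by its lower endpoint.
    have hcc : s(a, c) ≠ s(a', c') → c ≠ c' := by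
      rintro hs rfl
      obtain ⟨b, hb⟩ := hac
      obtain ⟨b', hb'⟩ := hac'
      exact hs (by rw [Subtype.ext (List.append_inj_left' (hb.symm.trans hb') rfl)])
    rcases h with ⟨rfl, rfl⟩ | ⟨rfl, rfl⟩ <;> rcases h' with ⟨rfl, rfl⟩ | ⟨rfl, rfl⟩
    · exact cross hac hac' (hcc hne) hx hx'
    · rw [gridEdge_comm (pos u')] at hx'
      rw [Sym2.eq_swap (a := u')] at hne
      obtain ⟨w, h1, h2, h3⟩ := cross hac hac' (hcc hne) hx hx'
      exact ⟨w, h1, h2.symm, h3⟩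
    · rw [gridEdge_comm (pos u)] at hx
      rw [Sym2.eq_swap (a := u)] at hne
      obtain ⟨w, h1, h2, h3⟩ := cross hac hac' (hcc hne) hx hx'
      exact ⟨w, h1.symm, h2, h3⟩
    · rw [gridEdge_comm (pos u')] at hx'
      rw [gridEdge_comm (pos u)] at hx
      rw [Sym2.eq_swap (a := u'), Sym2.eq_swap (a := u)] at hne
      obtain ⟨w, h1, h2, h3⟩ := cross hac hac' (hcc hne) hx hx'
      exact ⟨w, h1.symm, h2.symm, h3⟩
  refine ⟨pos, ⟨?_, hinj, ?_, ?_, ?_⟩⟩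
  · intro v
    obtain ⟨x, hx, hxv⟩ := (h1 v.1 v.2).2.2 (right_mem_halfEdge (h1 v.1 v.2).2.1)
    rw [hpos, ← hxv]
    simp only [gridBox, gridTranslate, Set.mem_ofPred_eq, Equiv.coe_fn_mk] at hx ⊢
    omega
  · intro u v huv
    obtain ⟨a, c, hac, h⟩ := exists_edge_of_adj huv
    have h3 := (h1 c.1 c.2).1
    rw [hpar hac, ← hpos] at h3
    rcases h with ⟨rfl, rfl⟩ | ⟨rfl, rfl⟩
    · exact h3
    · exact h3.imp Eq.symm Eq.symm
  · intro u v w huv hw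
    have hw' : pos w ∈ gridEdge (pos u) (pos v) := by simpa [gridPoint] using floor_mem_gridEdge hw
    obtain ⟨a, c, hac, h⟩ := exists_edge_of_adj huv
    rcases h with ⟨rfl, rfl⟩ | ⟨rfl, rfl⟩
    · exact avoid hac hw'
    · rw [gridEdge_comm] at hw'
      exact (avoid hac hw').symm
  · rintro u v u' v' huv huv' hne x ⟨hx, hx'⟩
    -- Rounding a common real point down and up gives two lattice points of both edges, hence common
    -- endpoints `w` and `z`. If they agree, the point is a lattice point; otherwise both edges join
    -- `w` to `z` and coincide.
    obtain ⟨w, f1, f2, f3⟩ :=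
      cross' huv huv' hne (floor_mem_gridEdge hx) (floor_mem_gridEdge hx')
    obtain ⟨z, g1, g2, g3⟩ := cross' huv huv' hne (ceil_mem_gridEdge hx) (ceil_mem_gridEdge hx')
    by_cases hwz : w = z
    · refine ⟨w, f1, f2, ?_⟩
      rw [← f3]
      exact eq_gridPoint_of_floor_eq_ceil (by rw [f3, g3, hwz])
    · have e1 : s(u, v) = s(w, z) := by
        rcases f1 with rfl | rfl <;> rcases g1 with rfl | rfl <;>
          first | exact absurd rfl hwz | rfl | exact Sym2.eq_swap
      have e2 : s(u', v') = s(w, z) := by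
        rcases f2 with rfl | rfl <;> rcases g2 with rfl | rfl <;>
          first | exact absurd rfl hwz | rfl | exact Sym2.eq_swap
      exact absurd (e1.trans e2.symm) hne

/-! ### Bootstrapping -/

/-- All spines of size at most `4 ^ N` fit into width `4 N` and height about `K (size / N + s)`. -/
def LevelBound (N K s : ℕ) : Prop :=
  ∀ c : Spine, c ≠ [] → c.size ≤ 2 ^ (2 * N) →
    ∃ h, SpineFits outsideOrigin (4 * N - 1) h c ∧ h * N ≤ K * (c.size + N * s)

theorem levelBound_base {N : ℕ} (hN : 2 ≤ N) : LevelBound N (14 * N) 1 := by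
  intro c hc hs
  obtain ⟨h, h1, h2⟩ := exists_spineFits smallSpinesFit_one le_rfl le_rfl
    (show 1 + 2 * N ≤ 4 * N - 1 by omega) c hc hs
  refine ⟨h, h1, ?_⟩
  nlinarith

theorem LevelBound.step {a K s N : ℕ} (ha : LevelBound a K s) (hK : 1 ≤ K) (ha1 : 1 ≤ a)
    (hs : s ≤ a) (hN : N ≤ 2 ^ a) (hKN : 2 * K * a ≤ N) : LevelBound N (112 * K) a := by
  -- For size at most `a * M` the old bound gives height at most `K * (M + s) ≤ 2 * K * M ≤ N`,
  -- using `s ≤ a ≤ M`.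
  obtain ⟨M, hM⟩ : ∃ M, M = N / (2 * K) := ⟨_, rfl⟩
  have hM1 : 2 * K * M ≤ N := hM ▸ Nat.mul_div_le N (2 * K)
  have hM2 : a ≤ M := by
    rw [hM, Nat.le_div_iff_mul_le (by omega)]; linarith
  have hM3 : N ≤ 4 * K * M := by
    have h1 : N < 2 * K * (M + 1) := hM ▸ Nat.lt_mul_div_succ N (by omega)
    nlinarith
  have hMN : M ≤ N := by nlinarith
  have hN1 : 1 ≤ N := by omega
  have hyp : SmallSpinesFit (a * M) (4 * a - 1) N := by
    intro c hc hcs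
    -- Both factors of `a * M` are at most `2 ^ a`; this is why levels reach size `2 ^ (2 * N)` and
    -- not just `2 ^ N`.
    have h2a : a ≤ 2 ^ a := Nat.lt_two_pow_self.le
    obtain ⟨h, h1, h2⟩ := ha c hc (by
      calc c.size ≤ a * M := hcs
        _ ≤ 2 ^ a * 2 ^ a := Nat.mul_le_mul h2a (hMN.trans hN)
        _ = 2 ^ (2 * a) := by rw [two_mul, pow_add])
    refine h1.mono subset_rfl ?_
    have h3 : a * h ≤ a * N := by
      calc a * h = h * a := mul_comm _ _
        _ ≤ K * (c.size + a * s) := h2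
        _ ≤ K * (a * M + a * M) := by gcongr; omega
        _ = a * (2 * K * M) := by ring
        _ ≤ a * N := by gcongr
    exact Nat.le_of_mul_le_mul_left h3 (by omega)
  intro c hc hcs
  obtain ⟨h, h1, h2⟩ := exists_spineFits hyp hN1 (Nat.mul_pos ha1 (by omega))
    (show N + 2 * N ≤ 4 * N - 1 by omega) c hc hcs
  refine ⟨h, h1, ?_⟩
  have h3 : h * M ≤ 4 * (7 * c.size + 4 * (a * M)) := by
    refine le_of_mul_le_mul_left (a := a) ?_ ha1
    have h4 : 4 * a - 1 + 1 = 4 * a := by omega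
    rw [h4] at h2
    linarith
  calc h * N ≤ h * (4 * K * M) := by gcongr
    _ = 4 * K * (h * M) := by ring
    _ ≤ 4 * K * (4 * (7 * c.size + 4 * (a * M))) := by gcongr
    _ = 112 * K * c.size + 32 * a * (2 * K * M) := by ring
    _ ≤ 112 * K * c.size + 32 * a * N := by gcongr
    _ ≤ 112 * K * c.size + 112 * K * (N * a) := by
        have : a * N ≤ K * (a * N) := Nat.le_mul_of_pos_left _ hK
        nlinarith
    _ = 112 * K * (c.size + N * a) := by ring

/-! ### Iterated logarithm and the recursion -/

theorem logb_two_le_sub_one {x : ℝ} (hx : 2 ≤ x) : Real.logb 2 x ≤ x - 1 := by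
  rw [Real.logb_le_iff_le_rpow one_lt_two (by linarith)]
  have := one_add_mul_self_le_rpow_one_add (s := 1) (by norm_num) (p := x - 1) (by linarith)
  norm_num at this
  linarith

theorem exists_iterate_logb_le_one (x : ℝ) : ∃ k : ℕ, (Real.logb 2)^[k] x ≤ 1 := by
  have key : ∀ (m : ℕ) (x : ℝ), x ≤ m + 1 → ∃ k : ℕ, (Real.logb 2)^[k] x ≤ 1 := by
    intro m
    induction m with
    | zero => exact fun x hx => ⟨0, by simpa using hx⟩
    | succ m ih =>
      intro x hx
      by_cases h1 : x ≤ 1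
      · exact ⟨0, h1⟩
      have h2 : Real.logb 2 x ≤ m + 1 := by
        rcases le_total 2 x with h2 | h2
        · have := logb_two_le_sub_one h2
          push_cast at hx
          linarith
        · have : Real.logb 2 x ≤ 1 := by
            rw [Real.logb_le_iff_le_rpow one_lt_two (by linarith)]; simpa using h2
          have : (0 : ℝ) ≤ m := m.cast_nonneg
          linarith
      obtain ⟨k, hk⟩ := ih _ h2
      exact ⟨k + 1, by simpa using hk⟩
  obtain ⟨m, hm⟩ := exists_nat_ge x
  exact key m x (by linarith)

theorem iterate_logStar_le_one (x : ℝ) : (Real.logb 2)^[logStar x] x ≤ 1 :=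
  Nat.sInf_mem (exists_iterate_logb_le_one x)

theorem logStar_logb_lt {x : ℝ} (hx : 1 < x) : logStar (Real.logb 2 x) + 1 ≤ logStar x := by
  have h := iterate_logStar_le_one x
  rcases hk : logStar x with _ | k
  · rw [hk] at h
    exact absurd h (not_le.2 hx)
  · rw [hk, Function.iterate_succ_apply] at h
    exact Nat.succ_le_succ (Nat.sInf_le h)

theorem mul_sq_le_two_pow {a : ℕ} (ha : 14 ≤ a) : 28 * a ^ 2 ≤ 2 ^ (a - 1) := by
  induction a, ha using Nat.le_induction with
  | base => norm_num
  | succ n hn ih =>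
    have h1 : 2 ^ (n + 1 - 1) = 2 * 2 ^ (n - 1) := by
      rw [← pow_succ']; congr 1; omega
    rw [h1]
    nlinarith

/-- The last bound, `K ≤ 14 * ⌈A⌉₊`, is carried along only for the induction: at `log A` it yields
the condition `2 * K * a ≤ N` of `LevelBound.step`. -/
theorem exists_levelBound (k : ℕ) : ∀ A : ℝ, 1 < A → logStar A ≤ k →
    ∃ K s : ℕ, 1 ≤ K ∧ s ≤ ⌈Real.logb 2 A⌉₊ ∧ LevelBound ⌈A⌉₊ K s ∧
      K ≤ 2 ^ 18 * 112 ^ k ∧ K ≤ 14 * ⌈A⌉₊ := by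
  induction k with
  | zero =>
    intro A hA hk
    have := logStar_logb_lt hA
    omega
  | succ k ih =>
    intro A hA hk
    have hpos : 0 < Real.logb 2 A := Real.logb_pos one_lt_two hA
    have hN2 : 2 ≤ ⌈A⌉₊ := Nat.lt_ceil.2 (by simpa using hA)
    -- From `2 ^ 14` on, `a = ⌈log A⌉₊ ≥ 14` and `28 * a ^ 2 ≤ 2 ^ (a - 1) ≤ ⌈A⌉₊`. Below it the
    -- trivial factor `14 * ⌈A⌉₊` is at most `2 ^ 18`.
    rcases lt_or_ge A (2 ^ 14) with hA0 | hA0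
    · refine ⟨14 * ⌈A⌉₊, 1, by omega, Nat.ceil_pos.2 hpos, levelBound_base hN2, ?_, le_rfl⟩
      have h1 : ⌈A⌉₊ ≤ 2 ^ 14 := Nat.ceil_le.2 (by exact_mod_cast hA0.le)
      have h2 : 1 ≤ 112 ^ (k + 1) := Nat.one_le_pow _ _ (by norm_num)
      calc 14 * ⌈A⌉₊ ≤ 2 ^ 18 * 1 := by omega
        _ ≤ _ := Nat.mul_le_mul_left _ h2
    · have hα : 14 ≤ Real.logb 2 A := by
        rw [Real.le_logb_iff_rpow_le one_lt_two (by linarith)]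
        exact_mod_cast hA0
      have hk' := logStar_logb_lt hA
      obtain ⟨K, s, h1, h2, h3, h4, h5⟩ := ih (Real.logb 2 A) (by linarith) (by omega)
      have hexp : A = 2 ^ Real.logb 2 A := (Real.rpow_logb two_pos (by norm_num) (by linarith)).symm
      generalize hαeq : Real.logb 2 A = α at *
      have ha : 14 ≤ ⌈α⌉₊ := by exact_mod_cast hα.trans (Nat.le_ceil α)
      have hs : s ≤ ⌈α⌉₊ := h2.trans (Nat.ceil_mono (by
        have := logb_two_le_sub_one (x := α) (by linarith)
        linarith))
      have hN : ⌈A⌉₊ ≤ 2 ^ ⌈α⌉₊ := by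
        refine Nat.ceil_le.2 ?_
        rw [hexp]
        push_cast
        rw [← Real.rpow_natCast]
        exact Real.rpow_le_rpow_of_exponent_le one_le_two (Nat.le_ceil α)
      have hN' : 2 ^ (⌈α⌉₊ - 1) ≤ ⌈A⌉₊ := by
        have : ((2 ^ (⌈α⌉₊ - 1) : ℕ) : ℝ) ≤ A := by
          rw [hexp]
          push_cast
          rw [← Real.rpow_natCast]
          refine Real.rpow_le_rpow_of_exponent_le one_le_two ?_
          rw [Nat.cast_sub (by omega)]
          have := Nat.ceil_lt_add_one (a := α) (by linarith)
          push_cast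
          linarith
        exact_mod_cast this.trans (Nat.le_ceil A)
      have hsq := (mul_sq_le_two_pow ha).trans hN'
      refine ⟨112 * K, ⌈α⌉₊, by omega, le_rfl, h3.step h1 (by omega) hs hN (by nlinarith), ?_,
        by nlinarith⟩
      calc 112 * K ≤ 112 * (2 ^ 18 * 112 ^ k) := by gcongr
        _ = 2 ^ 18 * 112 ^ (k + 1) := by ring

/-! ### Conclusion -/

theorem SpineFits.exists_drawing {W h c} (hc : SpineFits outsideOrigin W h c) :
    ∃ pos : Vertex (Spine.plug c .nil) → ℤ × ℤ,
      IsStraightLineOrthogonalDrawing (treeGraph (Spine.plug c .nil)) (W + 1) h pos := by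
  have hh : 0 < h := by
    obtain ⟨e, -, g1, g2, -⟩ := hc
    omega
  refine isStraightLineOrthogonalDrawing_of_draws
    ((hc.treeFits (0, -1) (.inl ⟨rfl, by simp⟩)).mono ?_)
  rintro x (hx | hx)
  · simp only [halfEdge, gridBox, Set.mem_ofPred_eq, Prod.fst_zero, Prod.snd_zero] at hx ⊢
    omega
  · exact hx

theorem exists_drawing_of_numNodes_eq_two (t : BinaryTree Unit) (ht : t.numNodes = 2) :
    ∃ pos : Vertex t → ℤ × ℤ, IsStraightLineOrthogonalDrawing (treeGraph t) 2 2 pos := by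
  obtain ⟨c, -, h2, h3, -⟩ := exists_heavy_spine t (by rintro rfl; simp at ht)
  have hs := Spine.numNodes_plug c .nil
  rw [h2, ht] at hs
  rw [ht] at h3
  simp only [BinaryTree.numNodes] at hs
  have hfit : ∀ x ∈ c, SpineFits outsideOrigin 1 1 [x] := by
    intro x hx
    have h4 := h3 x hx
    obtain ⟨_ | ⟨_, l, r⟩, b⟩ := x
    · exact spineFits_singleton b (treeFits_nil _ _) le_rfl le_rfl
    · simp only [BinaryTree.numNodes] at h4
      omega
  rw [← h2]
  match c, hs, h3, hfit with
  | [], hs, _, _ => simp at hs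
  | [x], hs, h3, _ =>
    have := h3 x (by simp)
    simp at hs
    omega
  | [x, y], _, _, hfit =>
    have hQ : ∀ q ∈ outsideOrigin, q.2 ≤ 0 := by
      rintro q (⟨-, h⟩ | ⟨-, h⟩) <;> omega
    exact ((hfit x (by simp)).append hQ
      ((hfit y (by simp)).mono aboveOrigin_subset le_rfl)).exists_drawing
  | x :: y :: z :: c, hs, _, _ =>
    simp at hs
    omega

end BinaryTreeDrawing

open BinaryTreeDrawing in
theorem mainTheorem11 :
    ∃ C c : ℝ, ∀ n : ℕ, 2 ≤ n → ∀ A : ℝ,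
      Real.logb 2 (n : ℝ) ≤ A → A ≤ (n : ℝ) / Real.logb 2 (n : ℝ) →
      ∀ t : BinaryTree Unit, t.numNodes = n →
        ∃ (W H : ℕ) (pos : BinaryTreeDrawing.Vertex t → ℤ × ℤ),
          BinaryTreeDrawing.IsStraightLineOrthogonalDrawing
            (BinaryTreeDrawing.treeGraph t) W H pos ∧
          (W : ℝ) ≤ C * A ∧
          (H : ℝ) ≤ ((n : ℝ) / A) * (2 : ℝ) ^ (c * (BinaryTreeDrawing.logStar A : ℝ)) := by
  -- The width is `4 * ⌈A⌉₊ ≤ 8 * A`. The exponent is `20 + 7`: `3 * 2 ^ 18 ≤ 2 ^ 20`, and `112 ≤ 2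
  -- ^ 7` per logarithm.
  refine ⟨8, 27, fun n hn A hA1 hA2 t ht => ?_⟩
  have hn' : (2 : ℝ) ≤ n := by exact_mod_cast hn
  have hlog1 : 1 ≤ Real.logb 2 n := by
    rw [Real.le_logb_iff_rpow_le one_lt_two (by linarith)]; simpa using hn'
  -- At `A = 1` the iterated logarithm is `0` and no constant can be absorbed, so the resulting case
  -- `n = 2` is drawn exactly.
  rcases (hlog1.trans hA1).eq_or_lt with rfl | hA
  · have hn2 : n = 2 := by
      have h1 : (n : ℝ) ≤ 2 := by
        simpa using (Real.logb_le_iff_le_rpow one_lt_two (by linarith)).1 hA1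
      have : n ≤ 2 := by exact_mod_cast h1
      omega
    subst hn2
    obtain ⟨pos, hpos⟩ := exists_drawing_of_numNodes_eq_two t ht
    have hstar : logStar 1 = 0 := Nat.sInf_eq_zero.2 (.inl (by simp))
    exact ⟨2, 2, pos, hpos, by norm_num, by rw [hstar]; norm_num⟩
  · obtain ⟨K, s, h1, h2, h3, h4, -⟩ := exists_levelBound (logStar A) A hA le_rfl
    have hstar : 1 ≤ logStar A := le_trans (by omega) (logStar_logb_lt hA)
    have hA0 : 0 < A := by linarith
    have hAN : A ≤ ⌈A⌉₊ := Nat.le_ceil A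
    have hNA : (⌈A⌉₊ : ℝ) < A + 1 := Nat.ceil_lt_add_one hA0.le
    have hnN : n ≤ 2 ^ (2 * ⌈A⌉₊) := by
      have h5 : (n : ℝ) ≤ 2 ^ A := (Real.logb_le_iff_le_rpow one_lt_two (by linarith)).1 hA1
      have h6 : (2 : ℝ) ^ A ≤ 2 ^ ((2 * ⌈A⌉₊ : ℕ) : ℝ) :=
        Real.rpow_le_rpow_of_exponent_le one_le_two (by push_cast; linarith)
      rw [Real.rpow_natCast] at h6
      exact_mod_cast h5.trans h6
    obtain ⟨c, hc, hct, -⟩ := exists_heavy_spine t (by rintro rfl; simp at ht; omega)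
    have hcs := Spine.numNodes_plug c .nil
    rw [hct, ht] at hcs
    simp only [BinaryTree.numNodes, add_zero] at hcs
    obtain ⟨h, h5, h6⟩ := h3 c hc (hcs ▸ hnN)
    have hdraw := h5.exists_drawing
    rw [hct] at hdraw
    obtain ⟨pos, hpos⟩ := hdraw
    rw [← hcs] at h6
    have hN1 : 1 ≤ ⌈A⌉₊ := Nat.ceil_pos.2 hA0
    refine ⟨_, _, pos, hpos, ?_, ?_⟩
    · rw [Nat.sub_add_cancel (by omega)]
      push_cast
      linarith
    -- This is where `A ≤ n / log n` enters: as `s ≤ ⌈log A⌉₊ ≤ 2 * log n`, the additive height term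
    -- `K * s` is `O(K * n / A)`.
    · have hsA : (s : ℝ) * A ≤ 2 * n := by
        have h7 : Real.logb 2 A ≤ Real.logb 2 n := by
          refine Real.logb_le_logb_of_le one_lt_two hA0 (hA2.trans ?_)
          exact div_le_self (by linarith) hlog1
        have h8 : (s : ℝ) ≤ 2 * Real.logb 2 n := by
          have h9 : (s : ℝ) ≤ ⌈Real.logb 2 A⌉₊ := by exact_mod_cast h2
          have := Nat.ceil_lt_add_one (Real.logb_pos one_lt_two hA).le
          linarith
        have h10 : A * Real.logb 2 n ≤ n := (le_div_iff₀ (by linarith)).1 hA2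
        nlinarith
      have h7 : (h : ℝ) * ⌈A⌉₊ ≤ K * (n + ⌈A⌉₊ * s) := by exact_mod_cast h6
      have hN0 : (0 : ℝ) < ⌈A⌉₊ := by linarith
      have h8 : (h : ℝ) * A ≤ K * (3 * n) := by
        have h9 : (h : ℝ) * A * ⌈A⌉₊ ≤ K * (3 * n) * ⌈A⌉₊ := by
          calc (h : ℝ) * A * ⌈A⌉₊ = A * (h * ⌈A⌉₊) := by ring
            _ ≤ A * (K * (n + ⌈A⌉₊ * s)) := by gcongr
            _ = K * (A * n + ⌈A⌉₊ * (s * A)) := by ring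
            _ ≤ K * (⌈A⌉₊ * n + ⌈A⌉₊ * (2 * n)) := by gcongr
            _ = _ := by ring
        exact le_of_mul_le_mul_right h9 hN0
      have h9 : 3 * K ≤ 2 ^ (27 * logStar A) := by
        calc 3 * K ≤ 2 ^ 2 * (2 ^ 18 * 112 ^ logStar A) := by gcongr; norm_num
          _ ≤ 2 ^ 2 * (2 ^ 18 * (2 ^ 7) ^ logStar A) := by gcongr; norm_num
          _ = 2 ^ (20 + 7 * logStar A) := by rw [← pow_mul, ← mul_assoc, ← pow_add, ← pow_add]
          _ ≤ 2 ^ (27 * logStar A) := Nat.pow_le_pow_right two_pos (by omega)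
      have h10 : (3 * K : ℝ) ≤ 2 ^ (27 * (logStar A : ℝ)) := by
        have h11 : (27 * (logStar A : ℝ)) = ((27 * logStar A : ℕ) : ℝ) := by push_cast; ring
        rw [h11, Real.rpow_natCast]
        exact_mod_cast h9
      rw [div_mul_eq_mul_div, le_div_iff₀ hA0]
      calc (h : ℝ) * A ≤ K * (3 * n) := h8
        _ = n * (3 * K) := by ring
        _ ≤ _ := by gcongr
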